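/- Let $0\le n\le d-1$ and $k\in\{1,\dots,d\}$, and let $e_k$ be the $k$-th unit vector of $\mathbb{R}^d$. A polytope is the convex hull of finitely many points. Its faces are the sets $P\cap\{x:\pi^{T}x=\pi_0\}$, where the inequality $\pi^{T}x\le\pi_0$ holds on all of $P$; thus $\emptyset$ and $P$ are faces. The dimension of a nonempty set is that of its affine hull, and for an integer $l\ge 0$ an $l$-face is a (nonempty) face of dimension $l$. For $S\subset\mathbb{R}^d$ put $$\mathrm{proj}_k(S)=\{p-p_ke_k : p\in S\},\qquad \mathrm{sweep}_k(S)=\{p-\theta p_ke_k : p\in S,\ \theta\in[0,1]\}.$$ Let $P\subset\{x\in\mathbb{R}^d : x_k>0\}$ be an $n$-dimensional (in particular nonempty) polytope, and suppose that some hyperplane containing $P$ is not orthogonal to the hyperplane $\{x_k=0\}$ (two hyperplanes being orthogonal when their normal vectors are). Then: (i) $\mathrm{sweep}_k(P)$ is an $(n+1)$-dimensional polytope. (ii) For every integer $l\ge 0$, a set $F$ is an $l$-face of $\mathrm{sweep}_k(P)$ if and only if $F$ is an $l$-face of $P$, or $F$ is an $l$-face of $\mathrm{proj}_k(P)$, or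 $l\ge1$ and $F=\mathrm{sweep}_k(\Gamma)$ for some $(l-1)$-face $\Gamma$ of $P$. (iii) Every face of $P$ and every face of $\mathrm{proj}_k(P)$ is a face of $\mathrm{sweep}_k(P)$, and $\mathrm{sweep}_k(\Gamma)$ is a face of $\mathrm{sweep}_k(P)$ for every face $\Gamma$ of $P$. -/

import Mathlib

namespace Sweep

/-- The hyperplane `{x | πᵀ x = c}` in `ℝᵈ`. -/
def hyperplane {d : ℕ} (π : EuclideanSpace ℝ (Fin d)) (c : ℝ) : Set (EuclideanSpace ℝ (Fin d)) :=
  {x | inner ℝ π x = c}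

/-- `H` is a hyperplane of `ℝᵈ`: a set `{x | πᵀ x = c}` with `π ≠ 0`. -/
def IsHyperplane {d : ℕ} (H : Set (EuclideanSpace ℝ (Fin d))) : Prop :=
  ∃ (π : EuclideanSpace ℝ (Fin d)) (c : ℝ), π ≠ 0 ∧ H = hyperplane π c

/-- The coordinate hyperplane `{x | x_k = 0}`. -/
def coordHyperplane {d : ℕ} (k : Fin d) : Set (EuclideanSpace ℝ (Fin d)) :=
  {x | x k = 0}

/-- Two hyperplanes are orthogonal if they have orthogonal (nonzero) normal vectors. -/
def HyperplanesOrthogonal {d : ℕ} (H H' : Set (EuclideanSpace ℝ (Fin d))) : Prop :=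
  ∃ (π π' : EuclideanSpace ℝ (Fin d)) (c c' : ℝ), π ≠ 0 ∧ π' ≠ 0 ∧
    H = hyperplane π c ∧ H' = hyperplane π' c' ∧ inner ℝ π π' = 0

/-- A polytope: the convex hull of finitely many points. -/
def IsPolytope {d : ℕ} (P : Set (EuclideanSpace ℝ (Fin d))) : Prop :=
  ∃ V : Set (EuclideanSpace ℝ (Fin d)), V.Finite ∧ P = convexHull ℝ V

/-- `S` is nonempty and its affine hull has dimension `n`. (The empty set has no dimension in `ℕ`.) -/
def HasDim {d : ℕ} (S : Set (EuclideanSpace ℝ (Fin d))) (n : ℕ) : Prop :=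
  S.Nonempty ∧ Module.finrank ℝ (affineSpan ℝ S).direction = n

/-- `F` is a face of `P`: `F = P ∩ {x | πᵀ x = π₀}` for some linear inequality `πᵀ x ≤ π₀` that is
valid on `P`. (The empty set and `P` itself are faces.) -/
def IsFace {d : ℕ} (P F : Set (EuclideanSpace ℝ (Fin d))) : Prop :=
  ∃ (π : EuclideanSpace ℝ (Fin d)) (c : ℝ),
    (∀ x ∈ P, inner ℝ π x ≤ c) ∧ F = P ∩ hyperplane π c

/-- `F` is an `l`-face of `P`: a face of dimension `l`. -/
def IsKFace {d : ℕ} (l : ℕ) (P F : Set (EuclideanSpace ℝ (Fin d))) : Prop :=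
  IsFace P F ∧ HasDim F l

/-- The projection of `P` along the `k`-th unit vector onto `{x | x_k = 0}`. -/
def proj {d : ℕ} (k : Fin d) (P : Set (EuclideanSpace ℝ (Fin d))) :
    Set (EuclideanSpace ℝ (Fin d)) :=
  {x | ∃ p ∈ P, x = p - p k • EuclideanSpace.single k (1 : ℝ)}

/-- The sweep of `P` along the `k`-th unit vector. -/
def sweep {d : ℕ} (k : Fin d) (P : Set (EuclideanSpace ℝ (Fin d))) :
    Set (EuclideanSpace ℝ (Fin d)) :=
  {x | ∃ p ∈ P, ∃ θ ∈ Set.Icc (0 : ℝ) 1, x = p - (θ * p k) • EuclideanSpace.single k (1 : ℝ)}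

end Sweep

namespace Sweep

variable {d : ℕ} {k : Fin d} {P G F : Set (EuclideanSpace ℝ (Fin d))}

/-! Along the segment from `p` to its projection a functional `π` changes by `-θ * p k * π k`, and
`p k > 0`. So the sign of `π k` decides whether a face of the sweep lies in `P`, lies in the
projection, or consists of whole segments. Conversely, the hypothesis on the hyperplane gives `ν`
constant on `P` with `ν k ≠ 0`. Adding multiples of `ν` to a normal keeps the face of `P` but makes
`π k` arbitrary, so each face of `P` yields both itself and its sweep (`IsFace.exists_normal`). The
same `ν` puts the unit vector outside the direction of `P`, so sweeping raises dimension by one. -/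

theorem inner_single_right (π : EuclideanSpace ℝ (Fin d)) (k : Fin d) :
    inner ℝ π (EuclideanSpace.single k (1 : ℝ)) = π k := by
  simp [EuclideanSpace.inner_single_right]

theorem inner_sub_smul_single (π x : EuclideanSpace ℝ (Fin d)) (k : Fin d) (a : ℝ) :
    inner ℝ π (x - a • EuclideanSpace.single k (1 : ℝ)) = inner ℝ π x - a * π k := by
  rw [inner_sub_right, inner_smul_right, inner_single_right]

theorem coordHyperplane_eq (k : Fin d) :
    coordHyperplane k = hyperplane (EuclideanSpace.single k (1 : ℝ)) 0 := by
  ext x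
  simp [coordHyperplane, hyperplane, EuclideanSpace.inner_single_left]

/-- A hyperplane not orthogonal to `{x | x k = 0}` has a normal vector with nonzero `k`-th
coordinate. -/
theorem exists_normal_of_not_orthogonal {H : Set (EuclideanSpace ℝ (Fin d))}
    (hH : IsHyperplane H) (hk : ¬ HyperplanesOrthogonal H (coordHyperplane k)) :
    ∃ (ν : EuclideanSpace ℝ (Fin d)) (c : ℝ), ν k ≠ 0 ∧ ∀ x ∈ H, inner ℝ ν x = c := by
  obtain ⟨ν, c, hν, rfl⟩ := hH
  refine ⟨ν, c, fun h0 => hk ?_, fun x hx => hx⟩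
  exact ⟨ν, EuclideanSpace.single k 1, c, 0, hν, by simp, rfl, coordHyperplane_eq k, by
    rw [inner_single_right, h0]⟩

theorem subset_sweep (k : Fin d) (P : Set (EuclideanSpace ℝ (Fin d))) : P ⊆ sweep k P :=
  fun p hp => ⟨p, hp, 0, by simp, by simp⟩

theorem proj_subset_sweep (k : Fin d) (P : Set (EuclideanSpace ℝ (Fin d))) :
    proj k P ⊆ sweep k P := by
  rintro _ ⟨p, hp, rfl⟩
  exact ⟨p, hp, 1, by simp, by simp⟩

/-- The faces of the sweep whose normal vector points upwards are faces of `P`. -/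
theorem sweep_inter_hyperplane_of_pos (hpos : P ⊆ {x | 0 < x k})
    {π : EuclideanSpace ℝ (Fin d)} {c : ℝ} (hπ : 0 < π k) (hP : ∀ x ∈ P, inner ℝ π x ≤ c) :
    sweep k P ∩ hyperplane π c = P ∩ hyperplane π c := by
  ext x
  refine ⟨?_, fun hx => ⟨subset_sweep k P hx.1, hx.2⟩⟩
  rintro ⟨⟨p, hp, θ, hθ, rfl⟩, hx⟩
  have hpk : 0 < p k := hpos hp
  have h1 := hP p hp
  have hx' : inner ℝ π p - θ * p k * π k = c := by rw [← inner_sub_smul_single]; exact hx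
  have h2 : 0 ≤ p k * π k := by positivity
  have h3 : θ = 0 := by
    by_contra hne
    have h4 : 0 < θ := lt_of_le_of_ne hθ.1 (Ne.symm hne)
    have h5 : 0 < θ * p k * π k := by positivity
    linarith
  subst h3
  refine ⟨by simpa using hp, hx⟩

/-- The faces of the sweep whose normal vector points downwards are faces of the projection. -/
theorem sweep_inter_hyperplane_of_neg (hpos : P ⊆ {x | 0 < x k})
    {π : EuclideanSpace ℝ (Fin d)} {c : ℝ} (hπ : π k < 0)
    (hP : ∀ x ∈ proj k P, inner ℝ π x ≤ c) :
    sweep k P ∩ hyperplane π c = proj k P ∩ hyperplane π c := by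
  ext x
  refine ⟨?_, fun hx => ⟨proj_subset_sweep k P hx.1, hx.2⟩⟩
  rintro ⟨⟨p, hp, θ, hθ, rfl⟩, hx⟩
  have hpk : 0 < p k := hpos hp
  have h1 := hP _ ⟨p, hp, rfl⟩
  rw [inner_sub_smul_single] at h1
  have hx' : inner ℝ π p - θ * p k * π k = c := by rw [← inner_sub_smul_single]; exact hx
  have h3 : θ = 1 := by
    by_contra hne
    have h4 : 0 < 1 - θ := sub_pos.2 (lt_of_le_of_ne hθ.2 hne)
    have h5 : 0 < (1 - θ) * (p k * -π k) := mul_pos h4 (mul_pos hpk (neg_pos.2 hπ))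
    linarith
  subst h3
  exact ⟨⟨p, hp, by rw [one_mul]⟩, hx⟩

/-- The faces of the sweep whose normal vector is horizontal are sweeps of faces of `P`. -/
theorem sweep_inter_hyperplane_of_eq_zero {π : EuclideanSpace ℝ (Fin d)} (c : ℝ)
    (hπ : π k = 0) :
    sweep k P ∩ hyperplane π c = sweep k (P ∩ hyperplane π c) := by
  ext x
  constructor
  · rintro ⟨⟨p, hp, θ, hθ, rfl⟩, hx⟩
    have hx' : inner ℝ π p - θ * p k * π k = c := by rw [← inner_sub_smul_single]; exact hx
    rw [hπ, mul_zero, sub_zero] at hx'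
    exact ⟨p, ⟨hp, hx'⟩, θ, hθ, rfl⟩
  · rintro ⟨p, ⟨hp, hx⟩, θ, hθ, rfl⟩
    refine ⟨⟨p, hp, θ, hθ, rfl⟩, ?_⟩
    change inner ℝ π _ = c
    rw [inner_sub_smul_single, hπ, mul_zero, sub_zero]
    exact hx

/-- Inside the hyperplane `{x | ⟪ν, x⟫ = c}` with `ν k ≠ 0`, the normal vector of a face can be
chosen with any prescribed `k`-th coordinate. -/
theorem IsFace.exists_normal {ν : EuclideanSpace ℝ (Fin d)} {c : ℝ} (hν : ν k ≠ 0)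
    (hP : ∀ x ∈ P, inner ℝ ν x = c) (hF : IsFace P F) (a : ℝ) :
    ∃ (π : EuclideanSpace ℝ (Fin d)) (c' : ℝ), π k = a ∧
      (∀ x ∈ P, inner ℝ π x ≤ c') ∧ F = P ∩ hyperplane π c' := by
  obtain ⟨π, c₀, hle, rfl⟩ := hF
  have key : ∀ x ∈ P, inner ℝ (π + ((a - π k) / ν k) • ν) x
      = inner ℝ π x + (a - π k) / ν k * c := by
    intro x hx
    rw [inner_add_left, real_inner_smul_left, hP x hx]
  refine ⟨π + ((a - π k) / ν k) • ν, c₀ + (a - π k) / ν k * c, ?_, ?_, ?_⟩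
  · simp [div_mul_cancel₀ _ hν]
  · intro x hx
    rw [key x hx]
    linarith [hle x hx]
  · ext x
    refine and_congr_right fun hx => ?_
    change _ = _ ↔ _ = _
    rw [key x hx, add_left_inj]

theorem IsFace.sweep_of_face {ν : EuclideanSpace ℝ (Fin d)} {c : ℝ} (hν : ν k ≠ 0)
    (hP : ∀ x ∈ P, inner ℝ ν x = c) (hpos : P ⊆ {x | 0 < x k}) (hF : IsFace P F) :
    IsFace (sweep k P) F := by
  obtain ⟨π, c', hk, hle, rfl⟩ := hF.exists_normal hν hP 1
  refine ⟨π, c', ?_, (sweep_inter_hyperplane_of_pos hpos (by rw [hk]; exact one_pos) hle).symm⟩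
  rintro _ ⟨p, hp, θ, hθ, rfl⟩
  rw [inner_sub_smul_single, hk]
  have hpk : 0 < p k := hpos hp
  have := mul_nonneg hθ.1 hpk.le
  linarith [hle p hp]

/-- The projection has `k`-th coordinate zero, so the `k`-th entry of a normal can be reset to `-1`
without changing the face. -/
theorem IsFace.sweep_of_proj (hpos : P ⊆ {x | 0 < x k}) (hF : IsFace (proj k P) F) :
    IsFace (sweep k P) F := by
  obtain ⟨π, c, hle, rfl⟩ := hF
  set π' := π - (π k + 1) • EuclideanSpace.single k (1 : ℝ) with hπ'
  have hk : π' k = -1 := by simp [hπ']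
  have key : ∀ x ∈ proj k P, inner ℝ π' x = inner ℝ π x := by
    rintro _ ⟨p, -, rfl⟩
    rw [hπ', real_inner_comm, inner_sub_smul_single, real_inner_comm]
    simp
  have hle' : ∀ x ∈ proj k P, inner ℝ π' x ≤ c := fun x hx => (key x hx).trans_le (hle x hx)
  refine ⟨π', c, ?_, ?_⟩
  · rintro _ ⟨p, hp, θ, hθ, rfl⟩
    have hpk : 0 < p k := hpos hp
    have h1 := hle' _ ⟨p, hp, rfl⟩
    rw [inner_sub_smul_single, hk] at h1 ⊢
    have := mul_le_mul_of_nonneg_right hθ.2 hpk.le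
    linarith
  · rw [sweep_inter_hyperplane_of_neg hpos (by rw [hk]; norm_num) hle']
    ext x
    refine and_congr_right fun hx => ?_
    change _ = _ ↔ _ = _
    rw [key x hx]

theorem IsFace.sweep {ν : EuclideanSpace ℝ (Fin d)} {c : ℝ} (hν : ν k ≠ 0)
    (hP : ∀ x ∈ P, inner ℝ ν x = c) (hF : IsFace P F) :
    IsFace (sweep k P) (sweep k F) := by
  obtain ⟨π, c', hk, hle, rfl⟩ := hF.exists_normal hν hP 0
  refine ⟨π, c', ?_, (sweep_inter_hyperplane_of_eq_zero c' hk).symm⟩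
  rintro _ ⟨p, hp, θ, hθ, rfl⟩
  rw [inner_sub_smul_single, hk, mul_zero, sub_zero]
  exact hle p hp

/-- Every face of the sweep is a face of `P`, a face of its projection or the sweep of a face
of `P`. -/
theorem IsFace.of_sweep (hpos : P ⊆ {x | 0 < x k}) (hF : IsFace (Sweep.sweep k P) F) :
    IsFace P F ∨ IsFace (proj k P) F ∨ ∃ G, IsFace P G ∧ F = Sweep.sweep k G := by
  obtain ⟨π, c, hle, rfl⟩ := hF
  have hP : ∀ x ∈ P, inner ℝ π x ≤ c := fun x hx => hle x (subset_sweep k P hx)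
  have hQ : ∀ x ∈ proj k P, inner ℝ π x ≤ c := fun x hx => hle x (proj_subset_sweep k P hx)
  rcases lt_trichotomy (π k) 0 with h | h | h
  · exact Or.inr (Or.inl ⟨π, c, hQ, sweep_inter_hyperplane_of_neg hpos h hQ⟩)
  · exact Or.inr (Or.inr ⟨_, ⟨π, c, hP, rfl⟩, sweep_inter_hyperplane_of_eq_zero c h⟩)
  · exact Or.inl ⟨π, c, hP, sweep_inter_hyperplane_of_pos hpos h hP⟩

theorem vectorSpan_sweep (hpos : G ⊆ {x | 0 < x k}) (hne : G.Nonempty) :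
    vectorSpan ℝ (sweep k G) =
      vectorSpan ℝ G ⊔ Submodule.span ℝ {EuclideanSpace.single k (1 : ℝ)} := by
  apply le_antisymm
  · rw [vectorSpan_def, Submodule.span_le]
    rintro _ ⟨_, ⟨p, hp, θ, -, rfl⟩, _, ⟨q, hq, η, -, rfl⟩, rfl⟩
    refine Submodule.mem_sup.2 ⟨p - q, vsub_mem_vectorSpan ℝ hp hq,
      (η * q k - θ * p k) • EuclideanSpace.single k (1 : ℝ),
      Submodule.smul_mem _ _ (Submodule.mem_span_singleton_self _), ?_⟩
    simp only [vsub_eq_sub]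
    module
  · refine sup_le (vectorSpan_mono ℝ (subset_sweep k G)) ?_
    rw [Submodule.span_singleton_le_iff_mem]
    obtain ⟨p, hp⟩ := hne
    have hpk : p k ≠ 0 := (hpos hp).ne'
    have h := vsub_mem_vectorSpan ℝ (subset_sweep k G hp) (proj_subset_sweep k G ⟨p, hp, rfl⟩)
    -- The difference of `p` and its projection is `p k` times the unit vector.
    rw [vsub_eq_sub, sub_sub_cancel] at h
    exact (Submodule.smul_mem_iff _ hpk).1 h

theorem HasDim.sweep {ν : EuclideanSpace ℝ (Fin d)} {c : ℝ} {m : ℕ} (hν : ν k ≠ 0)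
    (hG : ∀ x ∈ G, inner ℝ ν x = c) (hpos : G ⊆ {x | 0 < x k}) (h : HasDim G m) :
    HasDim (sweep k G) (m + 1) := by
  refine ⟨h.1.mono (subset_sweep k G), ?_⟩
  have hle : vectorSpan ℝ G ≤ (innerSL ℝ ν).toLinearMap.ker := by
    rw [vectorSpan_def, Submodule.span_le]
    rintro _ ⟨p, hp, q, hq, rfl⟩
    simp [inner_sub_right, hG p hp, hG q hq]
  have hnot : EuclideanSpace.single k (1 : ℝ) ∉ vectorSpan ℝ G := by
    intro hmem
    have h0 : inner ℝ ν (EuclideanSpace.single k (1 : ℝ)) = 0 := by simpa using hle hmem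
    exact hν (by rwa [inner_single_right] at h0)
  have hfin : Module.finrank ℝ (vectorSpan ℝ G) = m := by
    rw [← direction_affineSpan]; exact h.2
  rw [direction_affineSpan, vectorSpan_sweep hpos h.1, Submodule.finrank_sup_span_singleton hnot,
    hfin]

theorem proj_eq_image (k : Fin d) (P : Set (EuclideanSpace ℝ (Fin d))) :
    proj k P = ((LinearMap.id : EuclideanSpace ℝ (Fin d) →ₗ[ℝ] EuclideanSpace ℝ (Fin d)) -
      (EuclideanSpace.proj k : EuclideanSpace ℝ (Fin d) →L[ℝ] ℝ).toLinearMap.smulRight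
        (EuclideanSpace.single k (1 : ℝ))) '' P := by
  ext x
  simp [proj, eq_comm]

theorem sweep_eq_convexJoin (hconv : Convex ℝ P) (hpos : P ⊆ {x | 0 < x k}) :
    sweep k P = convexJoin ℝ P (proj k P) := by
  ext x
  rw [mem_convexJoin]
  constructor
  · rintro ⟨p, hp, θ, hθ, rfl⟩
    refine ⟨p, hp, _, ⟨p, hp, rfl⟩, 1 - θ, θ, sub_nonneg.2 hθ.2, hθ.1, by ring, ?_⟩
    module
  · rintro ⟨p, hp, _, ⟨q, hq, rfl⟩, a, b, ha, hb, hab, rfl⟩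
    have hr := hconv hp hq ha hb hab
    have hrk : 0 < (a • p + b • q) k := hpos hr
    have hpk : 0 < p k := hpos hp
    have hqk : 0 < q k := hpos hq
    -- The point lies below `a • p + b • q`, at height `a * p k`, so the drop `θ` times the full
    -- height must equal `b * q k`.
    refine ⟨a • p + b • q, hr, b * q k / (a • p + b • q) k, ⟨by positivity, ?_⟩, ?_⟩
    · rw [div_le_one hrk]
      have : 0 ≤ a * p k := by positivity
      simpa using this
    · rw [div_mul_cancel₀ _ hrk.ne']
      module

/-- Projection is linear, so it commutes with convex hulls, and the join of two nonempty hulls is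
the hull of the union. -/
theorem IsPolytope.sweep (hP : IsPolytope P) (hne : P.Nonempty) (hpos : P ⊆ {x | 0 < x k}) :
    IsPolytope (sweep k P) := by
  obtain ⟨V, hV, rfl⟩ := hP
  have hVne : V.Nonempty := convexHull_nonempty_iff.1 hne
  refine ⟨V ∪ proj k V, hV.union ?_, ?_⟩
  · rw [proj_eq_image]
    exact hV.image _
  · rw [sweep_eq_convexJoin (convex_convexHull ℝ V) hpos, proj_eq_image, proj_eq_image,
      LinearMap.image_convexHull, convexHull_union hVne (hVne.image _)]

end Sweep


theorem mainTheorem7 (d n : ℕ) (k : Fin d) (P : Set (EuclideanSpace ℝ (Fin d)))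
    (hnd : n + 1 ≤ d)
    (hP : Sweep.IsPolytope P) (hdim : Sweep.HasDim P n)
    (hpos : P ⊆ {x | 0 < x k})
    (hH : ∃ H : Set (EuclideanSpace ℝ (Fin d)), Sweep.IsHyperplane H ∧ P ⊆ H ∧
      ¬ Sweep.HyperplanesOrthogonal H (Sweep.coordHyperplane k)) :
    (Sweep.IsPolytope (Sweep.sweep k P) ∧ Sweep.HasDim (Sweep.sweep k P) (n + 1)) ∧
    (∀ (l : ℕ) (F : Set (EuclideanSpace ℝ (Fin d))),
      Sweep.IsKFace l (Sweep.sweep k P) F ↔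
        Sweep.IsKFace l P F ∨ Sweep.IsKFace l (Sweep.proj k P) F ∨
          ∃ (m : ℕ) (G : Set (EuclideanSpace ℝ (Fin d))),
            m + 1 = l ∧ Sweep.IsKFace m P G ∧ F = Sweep.sweep k G) ∧
    (∀ F : Set (EuclideanSpace ℝ (Fin d)), Sweep.IsFace P F →
      Sweep.IsFace (Sweep.sweep k P) F) ∧
    (∀ F : Set (EuclideanSpace ℝ (Fin d)), Sweep.IsFace (Sweep.proj k P) F →
      Sweep.IsFace (Sweep.sweep k P) F) ∧
    (∀ F : Set (EuclideanSpace ℝ (Fin d)), Sweep.IsFace P F →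
      Sweep.IsFace (Sweep.sweep k P) (Sweep.sweep k F)) := by
  obtain ⟨H, hHyp, hPH, hort⟩ := hH
  obtain ⟨ν, c, hν, hHν⟩ := Sweep.exists_normal_of_not_orthogonal hHyp hort
  have hPν : ∀ x ∈ P, inner ℝ ν x = c := fun x hx => hHν x (hPH hx)
  have hsub : ∀ {G}, Sweep.IsFace P G → G ⊆ P := by
    rintro _ ⟨π, c', -, rfl⟩
    exact Set.inter_subset_left
  have hdimG : ∀ {G m}, Sweep.IsFace P G → Sweep.HasDim G m →
      Sweep.HasDim (Sweep.sweep k G) (m + 1) := fun hG hm =>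
    hm.sweep hν (fun x hx => hPν x (hsub hG hx)) ((hsub hG).trans hpos)
  refine ⟨⟨hP.sweep hdim.1 hpos, hdim.sweep hν hPν hpos⟩, fun l F => ⟨?_, ?_⟩,
    fun F hF => hF.sweep_of_face hν hPν hpos, fun F hF => hF.sweep_of_proj hpos,
    fun F hF => hF.sweep hν hPν⟩
  · rintro ⟨hF, hl⟩
    rcases hF.of_sweep hpos with h | h | ⟨G, hG, rfl⟩
    · exact Or.inl ⟨h, hl⟩
    · exact Or.inr (Or.inl ⟨h, hl⟩)
    · have hGne : G.Nonempty := by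
        obtain ⟨_, p, hp, -⟩ := hl.1
        exact ⟨p, hp⟩
      -- The dimension of `G` is left to unification; comparing both dimensions of the sweep then
      -- forces it to be `l - 1`, with `l ≥ 1`.
      have hm : Sweep.HasDim G _ := ⟨hGne, rfl⟩
      exact Or.inr (Or.inr ⟨_, G, (hdimG hG hm).2.symm.trans hl.2, ⟨hG, hm⟩, rfl⟩)
  · rintro (⟨h, hl⟩ | ⟨h, hl⟩ | ⟨m, G, rfl, ⟨hG, hm⟩, rfl⟩)
    · exact ⟨h.sweep_of_face hν hPν hpos, hl⟩
    · exact ⟨h.sweep_of_proj hpos, hl⟩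
    · exact ⟨hG.sweep hν hPν, hdimG hG hm⟩
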